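/- Let $M$ be a Group OWL model with $n$ observations, $d$ features and $q$ tasks: a design matrix $X\in\mathbb R^{n\times d}$ with rows $x_1^\top,\dots,x_n^\top$, weights $\lambda_1\ge\dots\ge\lambda_d\ge 0$, and convex differentiable losses $f_1,\dots,f_n:\mathbb R^q\to\mathbb R$ with $\frac1L$-Lipschitz gradients ($L>0$). The primal objective is $$P(B)=\sum_{i=1}^n f_i(x_i^\top B)+\sum_{i=1}^d\lambda_i\|B_{[i],:}\|_2,\qquad B\in\mathbb R^{d\times q},$$ where $\|B_{[1],:}\|_2\ge\dots\ge\|B_{[d],:}\|_2$ are the ordered row norms; an optimum is a global minimizer of $P$. The dual objective is $D(\Theta)=-\sum_i f_i^\star(\Theta_{i,:})$ for $\Theta\in\mathbb R^{n\times q}$, where $f_i^\star$ is the convex conjugate of $f_i$. With $X_{:,j}$ the $j$-th column of $X$ (feature $j$), $\Theta$ is dual feasible if $D(\Theta)$ is finite and, for every $i$, the sum of the $i$ largest of the numbers $\|X_{:,j}^\top\Theta\|_2$ is at most $\lambda_1+\dots+\lambda_i$. The duality gap is $G(B,\Theta)=P(B)-D(\Theta)$. For $A\subseteq\{1,\dots,d\}$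 let $M_A$ be the reduced Group OWL model with the columns of $X$ in $A$, the weights $\lambda_1,\dots,\lambda_{|A|}$ and the same losses. Let $\Psi$ be any iterative algorithm for Group OWL models: for each model it has internal states, an initial state for each starting point $B^0$, and an iteration map, which may be deterministic or may use at each iteration an independent random element, with a fixed law, of a countable set (e.g. a mini-batch). The algorithm $\Psi$ with screening starts with $\mathcal A=\{1,\dots,d\}$ and works on $M_{\mathcal A}$. At the beginning of each iteration it takes the current iterate $B$ and some point $\Theta$, computed from the current state, that is dual feasible for $M_{\mathcal A}$; with $G=G(B,\Theta)$ for $M_{\mathcal A}$, it removes from $\mathcal A$ all features $j\in\mathcal A$ with $$\|X_{:,j}^\top\Theta\|_2+\|X_{:,j}\|_2\sqrt{2G/L}<\lambda_{|\mathcal A|},$$ and repeats this test with the new $\mathcal A$ until $\mathcal A$ is unchanged. If features were removed in this iteration, $\Psi$ is restarted on the new reduced model from a point given by its state (e.g. the current iterate or an extrapolated point), restricted to the remaining features. Then one iteration of $\Psi$ on $M_{\mathcal A}$ is done. Its iterates are regarded as matrices in $\mathbb R^{d\times q}$ with zero rows for removed features. Then: 1. If, for every $A\subseteq\{1,\dots,d\}$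 and every starting point, the iterates of $\Psi$ on $M_A$ converge almost surely to an optimum of $M_A$, then, for every starting point, the iterates of $\Psi$ with screening converge almost surely to an optimum of $M$. 2. The same holds with convergence of the iterates replaced by convergence of the objective values to an attained minimum. 3. Only features with zero optimal coefficients are ever removed: in every run of $\Psi$ with screening, whether or not $\Psi$ converges, if feature $i$ has been removed after some iteration, then $B^*_{i,:}=0$ for every optimum $B^*$ of $M$. -/

import Mathlib

open Filter Topology MeasureTheory

universe u v

noncomputable section

/-- The Euclidean norms of the rows of a matrix. -/
def rowNorm {m q : ℕ} (B : Matrix (Fin m) (Fin q) ℝ) (i : Fin m) : ℝ :=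
  ‖(WithLp.toLp 2 (B i) : EuclideanSpace ℝ (Fin q))‖

/-- The entries of `v` in non-increasing order: `sortDesc v i` is `v_[i]`. -/
def sortDesc {d : ℕ} (v : Fin d → ℝ) (i : Fin d) : ℝ :=
  v (Tuple.sort (fun j => -v j) i)

/-- A Group OWL model with `n` observations, `d` features and `q` tasks: the design matrix `X`,
the non-negative non-increasing weights `lam`, and the convex losses `f i`, whose gradients are
`1 / L`-Lipschitz. -/
structure GroupOWL (n d q : ℕ) where
  X : Matrix (Fin n) (Fin d) ℝ
  lam : Fin d → ℝ
  f : Fin n → EuclideanSpace ℝ (Fin q) → ℝ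
  L : ℝ
  lam_nonneg : ∀ i, 0 ≤ lam i
  lam_antitone : Antitone lam
  L_pos : 0 < L
  f_convex : ∀ i, ConvexOn ℝ Set.univ (f i)
  f_diff : ∀ i, Differentiable ℝ (f i)
  f_grad : ∀ i z w, ‖gradient (f i) z - gradient (f i) w‖ ≤ 1 / L * ‖z - w‖

namespace GroupOWL

variable {n d q : ℕ}

/-- The loss `F(B) = ∑ i, f_i (x_iᵀ B)`. -/
def loss (M : GroupOWL n d q) (B : Matrix (Fin d) (Fin q) ℝ) : ℝ :=
  ∑ i, M.f i (WithLp.toLp 2 ((M.X * B) i))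

/-- The Group OWL penalty `J_λ(B) = ∑ i, λ_i ‖B_[i]‖₂`. -/
def penalty (M : GroupOWL n d q) (B : Matrix (Fin d) (Fin q) ℝ) : ℝ :=
  ∑ i, M.lam i * sortDesc (rowNorm B) i

/-- The primal objective `P_λ(B)`. -/
def primal (M : GroupOWL n d q) (B : Matrix (Fin d) (Fin q) ℝ) : ℝ :=
  M.loss B + M.penalty B

/-- `B` is an optimum of the model: a global minimizer of the primal objective. -/
def IsOptimum (M : GroupOWL n d q) (B : Matrix (Fin d) (Fin q) ℝ) : Prop :=
  ∀ B', M.primal B ≤ M.primal B'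

/-- The convex conjugate of `f i` at `θ`, as a real supremum; it is only used at points where the
set is bounded above (see `DualFeasible`). -/
def conj (M : GroupOWL n d q) (i : Fin n) (θ : EuclideanSpace ℝ (Fin q)) : ℝ :=
  ⨆ z : EuclideanSpace ℝ (Fin q), (inner ℝ z θ - M.f i z)

/-- The dual objective `D(Θ) = ∑ i, - f_i^⋆(Θ_i)`. -/
def dual (M : GroupOWL n d q) (Θ : Matrix (Fin n) (Fin q) ℝ) : ℝ :=
  ∑ i, -M.conj i (WithLp.toLp 2 (Θ i))

/-- `Θ` is dual feasible: `D(Θ)` is finite, and the ordered norms `‖x_jᵀ Θ‖₂` (with `x_j` the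
`j`-th column of `X`) have partial sums dominated by those of the weights. -/
def DualFeasible (M : GroupOWL n d q) (Θ : Matrix (Fin n) (Fin q) ℝ) : Prop :=
  (∀ i, BddAbove (Set.range fun z : EuclideanSpace ℝ (Fin q) =>
      inner ℝ z (WithLp.toLp 2 (Θ i)) - M.f i z)) ∧
  ∀ i, ∑ j ∈ Finset.Iic i, sortDesc (rowNorm (M.X.transpose * Θ)) j ≤ ∑ j ∈ Finset.Iic i, M.lam j

/-- The duality gap `G(B, Θ) = P(B) - D(Θ)`. -/
def gap (M : GroupOWL n d q) (B : Matrix (Fin d) (Fin q) ℝ) (Θ : Matrix (Fin n) (Fin q) ℝ) : ℝ :=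
  M.primal B - M.dual Θ

/-- The reduced model on the features in `A`: the columns of `X` in `A`, in their order, with the
`|A|` largest weights and the same losses. -/
def restrict (M : GroupOWL n d q) (A : Finset (Fin d)) : GroupOWL n A.card q where
  X := M.X.submatrix id (A.orderEmbOfFin rfl)
  lam := fun i => M.lam (Fin.castLE (card_finset_fin_le A) i)
  f := M.f
  L := M.L
  lam_nonneg := fun _ => M.lam_nonneg _
  lam_antitone := fun _ _ h => M.lam_antitone h
  L_pos := M.L_pos
  f_convex := M.f_convex
  f_diff := M.f_diff
  f_grad := M.f_grad

/-- One screening test over the active set `A`: every feature `i` in `A` with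
`‖x_iᵀ Θ‖₂ + ‖x_i‖₂ √(2 G / L) < λ_{|A|}` is removed (weights are indexed from `0` here). -/
def screenPass (M : GroupOWL n d q) (Θ : Matrix (Fin n) (Fin q) ℝ) (G : ℝ)
    (A : Finset (Fin d)) : Finset (Fin d) :=
  open Classical in
  A.filter fun i =>
    ¬ (rowNorm (M.X.transpose * Θ) i + rowNorm M.X.transpose i * √(2 * G / M.L) <
      M.lam ⟨A.card - 1, by have := card_finset_fin_le A; have := i.pos; omega⟩)

/-- The screening test is repeated until the active set is unchanged; as every pass that changes
the active set removes a feature, `d` passes are enough (`screenPass_screen`). -/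
def screen (M : GroupOWL n d q) (Θ : Matrix (Fin n) (Fin q) ℝ) (G : ℝ)
    (A : Finset (Fin d)) : Finset (Fin d) :=
  (M.screenPass Θ G)^[d] A

/-- The set returned by the screening loop is unchanged by one more pass. -/
theorem screenPass_screen (M : GroupOWL n d q) (Θ : Matrix (Fin n) (Fin q) ℝ) (G : ℝ)
    (A : Finset (Fin d)) : M.screenPass Θ G (M.screen Θ G A) = M.screen Θ G A := by
  have sub : ∀ A, M.screenPass Θ G A ⊆ A := fun A => Finset.filter_subset _ _
  have key : ∀ k, M.screenPass Θ G ((M.screenPass Θ G)^[k] A) = (M.screenPass Θ G)^[k] A ∨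
      ((M.screenPass Θ G)^[k] A).card + k ≤ d := by
    intro k
    induction k with
    | zero => exact Or.inr (by simpa using card_finset_fin_le A)
    | succ k ih =>
      rw [Function.iterate_succ_apply']
      by_cases h : M.screenPass Θ G ((M.screenPass Θ G)^[k] A) = (M.screenPass Θ G)^[k] A
      · left; rw [h, h]
      · right
        have h1 := Finset.card_lt_card (lt_of_le_of_ne (sub _) h)
        have h2 := ih.resolve_left h
        omega
  rcases key d with h | h
  · exact h
  · have h0 : M.screen Θ G A = ∅ := Finset.card_eq_zero.mp (by unfold screen; omega)
    rw [h0]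
    exact Finset.subset_empty.mp (sub ∅)

/-- The rows in `A` of a coefficient matrix. -/
def restrictCoeff (A : Finset (Fin d)) (B : Matrix (Fin d) (Fin q) ℝ) :
    Matrix (Fin A.card) (Fin q) ℝ :=
  B.submatrix (A.orderEmbOfFin rfl) id

/-- The coefficient matrix of the full model with the rows of `B` on `A` and zero rows off `A`. -/
def extendCoeff (A : Finset (Fin d)) (B : Matrix (Fin A.card) (Fin q) ℝ) :
    Matrix (Fin d) (Fin q) ℝ :=
  Matrix.of (Function.extend (A.orderEmbOfFin rfl) (fun i => B i) 0)

/-- The iterates `B k` converge to an optimum of the model. -/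
def IteratesConverge (M : GroupOWL n d q) (B : ℕ → Matrix (Fin d) (Fin q) ℝ) : Prop :=
  ∃ Bopt, M.IsOptimum Bopt ∧ Tendsto B atTop (𝓝 Bopt)

/-- The optimum is attained and the objective values of the iterates `B k` converge to it. -/
def ValuesConverge (M : GroupOWL n d q) (B : ℕ → Matrix (Fin d) (Fin q) ℝ) : Prop :=
  ∃ Bopt, M.IsOptimum Bopt ∧ Tendsto (fun k => M.primal (B k)) atTop (𝓝 (M.primal Bopt))

end GroupOWL

/-- An arbitrary iterative algorithm for Group OWL models, deterministic or randomized. Given a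
model it has internal states (which may hold momentum, step sizes, counters, and so on); `start`
is the initial state for a given starting point, `step` is one iteration, which may use a random
element of `Ξ` (a mini-batch, say; `Ξ = Unit` for a deterministic algorithm), `iterate` reads off
the current iterate, and `restartPoint` the point from which the algorithm is restarted when
features are removed (the current iterate, or an extrapolated point for accelerated methods). -/
structure IterativeAlgorithm (n q : ℕ) (Ξ : Type v) where
  State : {d : ℕ} → GroupOWL n d q → Type u
  start : {d : ℕ} → (M : GroupOWL n d q) → Matrix (Fin d) (Fin q) ℝ → State M
  step : {d : ℕ} → (M : GroupOWL n d q) → State M → Ξ → State M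
  iterate : {d : ℕ} → (M : GroupOWL n d q) → State M → Matrix (Fin d) (Fin q) ℝ
  restartPoint : {d : ℕ} → (M : GroupOWL n d q) → State M → Matrix (Fin d) (Fin q) ℝ

namespace IterativeAlgorithm

variable {n d q : ℕ} {Ξ : Type v}

/-- The states of the algorithm on `M` from the starting point `B₀`, with random inputs `ω`. -/
def run (Ψ : IterativeAlgorithm.{u} n q Ξ) (M : GroupOWL n d q) (B₀ : Matrix (Fin d) (Fin q) ℝ)
    (ω : ℕ → Ξ) : ℕ → Ψ.State M
  | 0 => Ψ.start M B₀
  | k + 1 => Ψ.step M (run Ψ M B₀ ω k) (ω k)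

/-- The iterates of the algorithm without screening. -/
def iterates (Ψ : IterativeAlgorithm.{u} n q Ξ) (M : GroupOWL n d q)
    (B₀ : Matrix (Fin d) (Fin q) ℝ) (ω : ℕ → Ξ) (k : ℕ) : Matrix (Fin d) (Fin q) ℝ :=
  Ψ.iterate M (Ψ.run M B₀ ω k)

/-- A state of the algorithm with screening: the active set and a state of the algorithm on the
model reduced to the active set. -/
def ScreenedState (Ψ : IterativeAlgorithm.{u} n q Ξ) (M : GroupOWL n d q) : Type u :=
  (A : Finset (Fin d)) × Ψ.State (M.restrict A)

/-- A rule that computes a dual point from the state of the algorithm. -/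
abbrev DualRule (Ψ : IterativeAlgorithm.{u} n q Ξ) : Type u :=
  {d : ℕ} → (M : GroupOWL n d q) → Ψ.State M → Matrix (Fin n) (Fin q) ℝ

/-- The active set after the screening done at the beginning of an iteration: the test uses the
current iterate, the dual point and their duality gap, all in the current reduced model. -/
def newActive (Ψ : IterativeAlgorithm.{u} n q Ξ) (dualPt : Ψ.DualRule) (M : GroupOWL n d q)
    (s : Ψ.ScreenedState M) : Finset (Fin d) :=
  M.screen (dualPt (M.restrict s.1) s.2)
    ((M.restrict s.1).gap (Ψ.iterate (M.restrict s.1) s.2) (dualPt (M.restrict s.1) s.2)) s.1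

open Classical in
/-- One iteration of the algorithm with screening: screen; if the active set has changed, restart
the algorithm on the reduced model at the restart point; then do one step of the algorithm on the
reduced model. -/
def screenedStep (Ψ : IterativeAlgorithm.{u} n q Ξ) (dualPt : Ψ.DualRule) (M : GroupOWL n d q)
    (s : Ψ.ScreenedState M) (ξ : Ξ) : Ψ.ScreenedState M :=
  if Ψ.newActive dualPt M s = s.1 then
    ⟨s.1, Ψ.step (M.restrict s.1) s.2 ξ⟩
  else
    ⟨Ψ.newActive dualPt M s,
      Ψ.step (M.restrict (Ψ.newActive dualPt M s))
        (Ψ.start (M.restrict (Ψ.newActive dualPt M s))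
          (GroupOWL.restrictCoeff (Ψ.newActive dualPt M s)
            (GroupOWL.extendCoeff s.1 (Ψ.restartPoint (M.restrict s.1) s.2)))) ξ⟩

/-- The states of the algorithm with screening; all features are active at first. -/
def screenedRun (Ψ : IterativeAlgorithm.{u} n q Ξ) (dualPt : Ψ.DualRule) (M : GroupOWL n d q)
    (B₀ : Matrix (Fin d) (Fin q) ℝ) (ω : ℕ → Ξ) : ℕ → Ψ.ScreenedState M
  | 0 => ⟨Finset.univ,
      Ψ.start (M.restrict Finset.univ) (GroupOWL.restrictCoeff Finset.univ B₀)⟩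
  | k + 1 => screenedStep Ψ dualPt M (screenedRun Ψ dualPt M B₀ ω k) (ω k)

/-- The active set after `k` iterations of the algorithm with screening. -/
def activeSet (Ψ : IterativeAlgorithm.{u} n q Ξ) (dualPt : Ψ.DualRule) (M : GroupOWL n d q)
    (B₀ : Matrix (Fin d) (Fin q) ℝ) (ω : ℕ → Ξ) (k : ℕ) : Finset (Fin d) :=
  (Ψ.screenedRun dualPt M B₀ ω k).1

/-- The iterates of the algorithm with screening, as coefficient matrices of the full model (the
removed features have zero coefficients). -/
def screenedIterates (Ψ : IterativeAlgorithm.{u} n q Ξ) (dualPt : Ψ.DualRule)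
    (M : GroupOWL n d q) (B₀ : Matrix (Fin d) (Fin q) ℝ) (ω : ℕ → Ξ) (k : ℕ) :
    Matrix (Fin d) (Fin q) ℝ :=
  GroupOWL.extendCoeff (Ψ.screenedRun dualPt M B₀ ω k).1
    (Ψ.iterate (M.restrict (Ψ.screenedRun dualPt M B₀ ω k).1)
      (Ψ.screenedRun dualPt M B₀ ω k).2)

end IterativeAlgorithm

end

/-! ### Sorted vectors and the OWL norm. -/

noncomputable section

/-! Safety. The losses are `1/L`-smooth, so the Fenchel–Young inequality gains a term `L/2 * ‖θ - ∇f
z‖²` (`fenchelYoung_add_sq_le`). Summed over the observations, with the pairing of `Xᵀ Θ` and `B`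
bounded by the penalty, it places the loss gradient at an optimum within `√(2G/L)` of any dual
feasible point (`sum_sq_sub_lossGrad_le`). A feature failing the test therefore has `‖x_jᵀ ∇F‖ <
λ_|A|`. If its optimal row were nonzero, shrinking that row slightly would lower the penalty at rate
at least `λ_|A|` and raise the loss at a smaller rate (`IsOptimum.row_eq_zero`). Every optimum thus
vanishes on removed features, by induction over passes and iterations, and no convergence is needed.

Convergence. Active sets decrease, so they stabilise, and from then on the run is a run of the plain
algorithm on a reduced model (`exists_eventually_screenedIterates_eq`). By safety, padded optima of
that model are optima of the full one.

Randomness. The restart time and point are random, while the hypothesis concerns fixed starting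
points. As `Ξ` is countable, only countably many states are reachable at each time, and the noise
law is shift invariant; a countable intersection of almost sure events covers all possible restarts
(`ae_exists_eventually_screenedIterates_eq`). -/

theorem antitone_sortDesc {d : ℕ} (v : Fin d → ℝ) : Antitone (sortDesc v) := fun i j h => by
  have := Tuple.monotone_sort (fun j => -v j) h
  simpa [sortDesc] using this

/-- A permutation of `v` that is non-increasing is `sortDesc v`. -/
theorem sortDesc_eq_of_antitone {d : ℕ} {v : Fin d → ℝ} {σ : Equiv.Perm (Fin d)}
    (h : Antitone fun i => v (σ i)) (i : Fin d) : sortDesc v i = v (σ i) := by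
  have h' : Monotone ((fun j => -v j) ∘ σ) := fun i j hij => neg_le_neg (h hij)
  have := congrFun (Tuple.comp_sort_eq_comp_iff_monotone.mpr h') i
  simp only [Function.comp_apply, neg_inj] at this
  exact this.symm

/-- The rearrangement inequality: the OWL norm is the maximum over all pairings with the weights. -/
theorem sum_mul_comp_perm_le_sum_mul_sortDesc {d : ℕ} {lam : Fin d → ℝ} (hl : Antitone lam)
    (v : Fin d → ℝ) (σ : Equiv.Perm (Fin d)) :
    ∑ i, lam i * v (σ i) ≤ ∑ i, lam i * sortDesc v i := by
  have h := (hl.monovary (antitone_sortDesc v)).sum_mul_comp_perm_le_sum_mul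
    (σ := σ.trans (Tuple.sort fun j => -v j).symm)
  simpa [sortDesc] using h

theorem sum_castLE {k d : ℕ} (h : k ≤ d) (w : Fin d → ℝ) :
    ∑ i : Fin k, w (Fin.castLE h i) = ∑ i : Fin d with i.val < k, w i := by
  refine Finset.sum_bij (fun i _ => Fin.castLE h i) ?_ ?_ ?_ ?_
  · intro i _; simp
  · intro i _ j _ hij; simpa using hij
  · intro j hj; exact ⟨⟨j, by simpa using hj⟩, Finset.mem_univ _, rfl⟩
  · intro i _; rfl

theorem sum_filter_castLE {k m d : ℕ} (h : m ≤ d) (hk : k ≤ m) (w : Fin d → ℝ) :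
    ∑ i : Fin m with i.val < k, w (Fin.castLE h i) = ∑ i : Fin d with i.val < k, w i := by
  rw [← sum_castLE hk fun i => w (Fin.castLE h i), ← sum_castLE (hk.trans h)]
  rfl

/-- The `k`-th element of `T` in increasing order, counted from `0`, is at least `k`, so its weight
is at most `w k`. -/
theorem Antitone.sum_le_sum_filter_lt_card {d : ℕ} {w : Fin d → ℝ} (hw : Antitone w)
    (T : Finset (Fin d)) : ∑ i ∈ T, w i ≤ ∑ i : Fin d with i.val < T.card, w i := by
  rw [← sum_castLE (card_finset_fin_le T)]
  conv_lhs => rw [← Finset.map_orderEmbOfFin_univ T rfl, Finset.sum_map]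
  refine Finset.sum_le_sum fun i _ => hw ?_
  have key : ∀ (k : ℕ) (hk : k < T.card), k ≤ (T.orderEmbOfFin rfl ⟨k, hk⟩ : Fin d) := by
    intro k
    induction k with
    | zero => intro _; exact Nat.zero_le _
    | succ k ih =>
      intro hk
      have h1 := ih (by omega)
      have h2 : T.orderEmbOfFin rfl ⟨k, by omega⟩ < T.orderEmbOfFin rfl ⟨k + 1, hk⟩ :=
        (T.orderEmbOfFin rfl).strictMono (by simp [Fin.lt_def])
      have h3 := Fin.lt_def.mp h2
      omega
  exact Fin.le_def.mpr (key i i.2)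

/-- The sum of `u` over a set with `k` elements is at most the sum of its `k` largest entries. -/
theorem sum_le_sum_sortDesc {d : ℕ} (u : Fin d → ℝ) (S : Finset (Fin d)) :
    ∑ j ∈ S, u j ≤ ∑ i : Fin d with i.val < S.card, sortDesc u i := by
  have h := (antitone_sortDesc u).sum_le_sum_filter_lt_card
    (S.map (Tuple.sort fun j => -u j).symm.toEmbedding)
  simpa [sortDesc] using h

/-- Summation by parts for a non-increasing sequence bounded below. -/
theorem mul_sum_le_sum_mul_of_antitone {d : ℕ} (c a : Fin d → ℝ) (b : ℝ) (ha : Antitone a)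
    (hb : ∀ i, b ≤ a i) (hc : ∀ k ≤ d, 0 ≤ ∑ i : Fin d with i.val < k, c i) :
    b * ∑ i, c i ≤ ∑ i, c i * a i := by
  induction d generalizing b with
  | zero => simp
  | succ d ih =>
    -- The prefix is bounded below by the last entry of `a`, not by the original `b`, which is why
    -- `b` is generalized.
    have h1 := ih (fun i => c i.castSucc) (fun i => a i.castSucc) (a (Fin.last d))
      (fun i j h => ha (by simpa using h)) (fun i => ha (Fin.le_last _)) (by
        intro k hk
        have h2 := hc k (by omega)
        rw [Finset.sum_filter, Fin.sum_univ_castSucc] at h2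
        rw [Finset.sum_filter]
        simpa [Nat.not_lt.mpr hk] using h2)
    have h3 : 0 ≤ ∑ i, c i := by
      have h4 := hc (d + 1) le_rfl
      rwa [Finset.filter_true_of_mem fun i _ => i.2] at h4
    rw [Fin.sum_univ_castSucc (fun i => c i * a i)]
    have h5 : ∑ i, c i = ∑ i : Fin d, c i.castSucc + c (Fin.last d) := Fin.sum_univ_castSucc _
    have h6 := mul_le_mul_of_nonneg_right (hb (Fin.last d)) h3
    calc b * ∑ i, c i ≤ a (Fin.last d) * ∑ i, c i := h6
      _ ≤ _ := by rw [h5]; linarith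

/-- If the sums of `u` over sets of `k` indices in `A` are at most the sum of the first `k`
weights, then the pairing of `u` with a non-negative vector supported in `A` is at most the OWL
norm of that vector. -/
theorem sum_mul_le_sum_mul_sortDesc {d : ℕ} {lam u v : Fin d → ℝ} (A : Finset (Fin d))
    (hl : ∀ i, 0 ≤ lam i) (hv : ∀ i, 0 ≤ v i) (hvA : ∀ i ∉ A, v i = 0)
    (hu : ∀ S ⊆ A, ∑ j ∈ S, u j ≤ ∑ i : Fin d with i.val < S.card, lam i) :
    ∑ j, u j * v j ≤ ∑ i, lam i * sortDesc v i := by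
  classical
  set τ := Tuple.sort fun j => -v j with hτ
  have h1 : ∑ j, u j * v j = ∑ i, (if τ i ∈ A then u (τ i) else 0) * sortDesc v i := by
    rw [← Equiv.sum_comp τ]
    refine Finset.sum_congr rfl fun i _ => ?_
    by_cases h : τ i ∈ A
    · rw [if_pos h]; rfl
    · simp [h, hvA _ h]
  -- Summation by parts in the order that sorts `v`. Indices off `A` are dropped because `hu` says
  -- nothing about them and `v` vanishes there.
  have h2 := mul_sum_le_sum_mul_of_antitone
    (fun i => lam i - if τ i ∈ A then u (τ i) else 0) (sortDesc v) 0 (antitone_sortDesc v)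
    (fun i => hv _) (by
      intro k hk
      rw [Finset.sum_sub_distrib, sub_nonneg]
      set T : Finset (Fin d) := {i : Fin d | (i : ℕ) < k ∧ τ i ∈ A} with hT
      have h3 : ∑ i : Fin d with i.val < k, (if τ i ∈ A then u (τ i) else 0)
          = ∑ j ∈ T.map τ.toEmbedding, u j := by
        rw [Finset.sum_map, ← Finset.sum_filter, Finset.filter_filter]
        rfl
      have h4 := hu (T.map τ.toEmbedding) (by
        intro j hj
        obtain ⟨i, hi, rfl⟩ := Finset.mem_map.mp hj
        exact (Finset.mem_filter.mp hi).2.2)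
      have h5 : T.card ≤ k := by
        have : T.card ≤ (Finset.univ.filter fun i : Fin d => (i : ℕ) < k).card :=
          Finset.card_le_card fun i hi => by
            simp only [hT, Finset.mem_filter, Finset.mem_univ, true_and] at hi ⊢
            exact hi.1
        refine this.trans ?_
        rw [Fin.card_filter_val_lt]
        exact min_le_right _ _
      rw [h3]
      -- `T` may have fewer than `k` elements; the missing weights are nonnegative.
      refine h4.trans (Finset.sum_le_sum_of_subset_of_nonneg ?_ fun i _ _ => hl i)
      intro i hi
      simp only [Finset.card_map, Finset.mem_filter, Finset.mem_univ, true_and] at hi ⊢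
      omega)
  simp only [zero_mul, sub_mul, Finset.sum_sub_distrib, sub_nonneg] at h2
  rw [h1]
  exact h2

/-- Decreasing one entry of a non-negative vector supported in `A`, while keeping it positive,
decreases its OWL norm by at least the last of the first `|A|` weights times the decrease. -/
theorem sum_mul_sortDesc_add_le {d : ℕ} {lam v v' : Fin d → ℝ} {A : Finset (Fin d)} {j : Fin d}
    {l : Fin d} (hl : Antitone lam) (hlA : (l : ℕ) = A.card - 1) (hne : ∀ i ≠ j, v' i = v i)
    (hj : 0 < v' j) (hjv : v' j ≤ v j) (hA : ∀ i ∉ A, v' i = 0) :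
    ∑ i, lam i * sortDesc v' i + lam l * (v j - v' j) ≤ ∑ i, lam i * sortDesc v i := by
  classical
  set σ := Tuple.sort fun j => -v' j with hσ
  -- Pairing `v` in the order that sorts `v'` gives a lower bound for its OWL norm, and this pairing
  -- differs from that of `v'` in one term only.
  refine le_trans ?_ (sum_mul_comp_perm_le_sum_mul_sortDesc hl v σ)
  have h1 : ∑ i, lam i * v (σ i) - ∑ i, lam i * sortDesc v' i
      = lam (σ.symm j) * (v j - v' j) := by
    rw [← Finset.sum_sub_distrib, Finset.sum_eq_single (σ.symm j)]
    · simp [sortDesc, ← hσ, mul_sub]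
    · intro i _ hi
      have : σ i ≠ j := fun h => hi (by rw [← h]; simp)
      simp [sortDesc, ← hσ, hne _ this]
    · simp
  -- Entries sorted up to the position of `j` are at least `v' j > 0`, hence lie in `A`; so that
  -- position is among the first `|A|`.
  have h2 : σ.symm j ≤ l := by
    have h3 : (Finset.Iic (σ.symm j)).card ≤ A.card := by
      refine Finset.card_le_card_of_injOn σ ?_ σ.injective.injOn
      intro i hi
      by_contra h
      have h4 := antitone_sortDesc v' (Finset.mem_Iic.mp hi)
      have h5 := hA _ h
      simp only [sortDesc, ← hσ, Equiv.apply_symm_apply] at h4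
      linarith
    rw [Fin.card_Iic] at h3
    rw [Fin.le_def]
    omega
  have h6 := mul_le_mul_of_nonneg_right (hl h2) (sub_nonneg.mpr hjv)
  linarith

/-- The OWL norm of a vector padded by zeros. -/
theorem sum_mul_sortDesc_of_extend {d : ℕ} (lam : Fin d → ℝ) {A : Finset (Fin d)}
    {w : Fin A.card → ℝ} {v : Fin d → ℝ} (hw : ∀ i, 0 ≤ w i)
    (h1 : ∀ i, v (A.orderEmbOfFin rfl i) = w i) (h0 : ∀ j ∉ A, v j = 0) :
    ∑ i, lam i * sortDesc v i
      = ∑ i, lam (Fin.castLE (card_finset_fin_le A) i) * sortDesc w i := by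
  classical
  let e₀ : {i : Fin d // (i : ℕ) < A.card} ≃ Fin A.card :=
    { toFun := fun x => ⟨x.1, x.2⟩
      invFun := fun i => ⟨Fin.castLE (card_finset_fin_le A) i, i.2⟩
      left_inv := fun _ => rfl
      right_inv := fun _ => rfl }
  -- The first `|A|` positions list `A` in the sorted order of `w`. Any extension to a permutation
  -- sends the other positions off `A`, where `v` is zero, and so sorts `v`.
  let e : {i : Fin d // (i : ℕ) < A.card} ≃ {j : Fin d // j ∈ A} :=
    (e₀.trans (Tuple.sort fun j => -w j)).trans (A.orderIsoOfFin rfl).toEquiv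
  have hlt : ∀ (i : Fin d) (hi : (i : ℕ) < A.card),
      v (e.extendSubtype i) = sortDesc w ⟨i, hi⟩ := by
    intro i hi
    rw [e.extendSubtype_apply_of_mem i hi]
    exact h1 _
  have hge : ∀ i : Fin d, ¬ (i : ℕ) < A.card → v (e.extendSubtype i) = 0 := fun i hi =>
    h0 _ (e.extendSubtype_not_mem i hi)
  have hanti : Antitone fun i => v (e.extendSubtype i) := by
    intro i j hij
    have hij' := Fin.le_def.mp hij
    show v (e.extendSubtype j) ≤ v (e.extendSubtype i)
    by_cases hj : (j : ℕ) < A.card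
    · rw [hlt j hj, hlt i (by omega)]
      exact antitone_sortDesc w (Fin.le_def.mpr hij')
    · rw [hge j hj]
      by_cases hi : (i : ℕ) < A.card
      · rw [hlt i hi]; exact hw _
      · rw [hge i hi]
  have h2 := sum_castLE (card_finset_fin_le A) fun i => lam i * sortDesc v i
  rw [Finset.sum_filter_of_ne] at h2
  · rw [← h2]
    refine Finset.sum_congr rfl fun i _ => ?_
    rw [sortDesc_eq_of_antitone hanti, hlt _ i.2]
    rfl
  · intro i _ hi
    by_contra! h
    rw [sortDesc_eq_of_antitone hanti, hge i (not_lt.mpr h), mul_zero] at hi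
    exact hi rfl

/-! ### Smoothness of the losses. -/

/-- The quadratic upper bound for a function with a `K`-Lipschitz gradient. -/
theorem le_add_inner_gradient_add_sq {E : Type*} [NormedAddCommGroup E] [InnerProductSpace ℝ E]
    [CompleteSpace E] {f : E → ℝ} {K : ℝ} (hf : Differentiable ℝ f)
    (hK : ∀ z w, ‖gradient f z - gradient f w‖ ≤ K * ‖z - w‖) (z h : E) :
    f (z + h) ≤ f z + inner ℝ (gradient f z) h + K / 2 * ‖h‖ ^ 2 := by
  -- The error of the bound along the segment; the Lipschitz condition makes its derivative
  -- nonpositive on `[0, 1]`.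
  set g : ℝ → ℝ := fun t => f (z + t • h) - t * inner ℝ (gradient f z) h - K / 2 * ‖h‖ ^ 2 * t ^ 2
    with hg
  have hd : ∀ t, HasDerivAt g (inner ℝ (gradient f (z + t • h)) h - inner ℝ (gradient f z) h
      - K * ‖h‖ ^ 2 * t) t := by
    intro t
    have h1 : HasDerivAt (fun t : ℝ => z + t • h) h t := by
      simpa using ((hasDerivAt_id t).smul_const h).const_add z
    have h2 : HasDerivAt (fun t : ℝ => f (z + t • h)) (inner ℝ (gradient f (z + t • h)) h) t := by
      have h3 := (hf (z + t • h)).hasGradientAt.hasFDerivAt.comp_hasDerivAt t h1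
      simp only [InnerProductSpace.toDual_apply_apply] at h3
      exact h3
    have h4 := (h2.sub ((hasDerivAt_id t).mul_const (inner ℝ (gradient f z) h))).sub
      (((hasDerivAt_id t).pow 2).const_mul (K / 2 * ‖h‖ ^ 2))
    exact h4.congr_deriv (by simp; ring)
  have hanti : AntitoneOn g (Set.Icc 0 1) := by
    refine antitoneOn_of_deriv_nonpos (convex_Icc 0 1)
      (fun t _ => (hd t).continuousAt.continuousWithinAt)
      (fun t _ => (hd t).differentiableAt.differentiableWithinAt) fun t ht => ?_
    rw [interior_Icc] at ht
    rw [(hd t).deriv, ← inner_sub_left]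
    have h5 := hK (z + t • h) z
    rw [add_sub_cancel_left, norm_smul, Real.norm_of_nonneg ht.1.le] at h5
    have h6 := (real_inner_le_norm (gradient f (z + t • h) - gradient f z) h).trans
      (mul_le_mul_of_nonneg_right h5 (norm_nonneg h))
    nlinarith
  have h7 := hanti (Set.left_mem_Icc.mpr zero_le_one) (Set.right_mem_Icc.mpr zero_le_one)
    zero_le_one
  simp only [hg, one_smul, zero_smul, add_zero, one_mul, zero_mul] at h7
  linarith

/-! ### Duality gap and safety of the screening test. -/

namespace GroupOWL

variable {n d q : ℕ}

theorem rowNorm_nonneg {m q : ℕ} (B : Matrix (Fin m) (Fin q) ℝ) (i : Fin m) : 0 ≤ rowNorm B i :=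
  norm_nonneg _

theorem rowNorm_eq_zero {m q : ℕ} {B : Matrix (Fin m) (Fin q) ℝ} {i : Fin m} :
    rowNorm B i = 0 ↔ B i = 0 := by
  simp [rowNorm]

/-- The gradients of the losses at a coefficient matrix. -/
def lossGrad (M : GroupOWL n d q) (B : Matrix (Fin d) (Fin q) ℝ) : Matrix (Fin n) (Fin q) ℝ :=
  Matrix.of fun i => (gradient (M.f i) (WithLp.toLp 2 ((M.X * B) i))).ofLp

/-- The Fenchel--Young inequality, strengthened by the smoothness of the loss. -/
theorem fenchelYoung_add_sq_le (M : GroupOWL n d q) (i : Fin n)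
    {θ : EuclideanSpace ℝ (Fin q)}
    (hθ : BddAbove (Set.range fun z : EuclideanSpace ℝ (Fin q) => inner ℝ z θ - M.f i z))
    (z : EuclideanSpace ℝ (Fin q)) :
    inner ℝ z θ + M.L / 2 * ‖θ - gradient (M.f i) z‖ ^ 2 ≤ M.f i z + M.conj i θ := by
  set g := gradient (M.f i) z
  -- This test point maximizes the lower bound on `⟨·, θ⟩ - f` that the quadratic upper bound at `z`
  -- provides.
  have h1 := le_ciSup hθ (z + M.L • (θ - g))
  have h2 := le_add_inner_gradient_add_sq (M.f_diff i) (M.f_grad i) z (M.L • (θ - g))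
  have h3 : (⨆ z : EuclideanSpace ℝ (Fin q), (inner ℝ z θ - M.f i z)) = M.conj i θ := rfl
  have h4 : inner ℝ (θ - g) θ - inner ℝ g (θ - g) = ‖θ - g‖ ^ 2 := by
    rw [← real_inner_self_eq_norm_sq, real_inner_comm (θ - g) g, ← inner_sub_right]
  have h5 : 1 / M.L / 2 * (M.L * ‖θ - g‖) ^ 2 = M.L / 2 * ‖θ - g‖ ^ 2 := by
    have := M.L_pos.ne'
    field_simp
  rw [norm_smul, Real.norm_of_nonneg M.L_pos.le, h5, inner_smul_right] at h2
  simp only [h3, inner_add_left, real_inner_smul_left] at h1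
  have h6 : M.L * inner ℝ (θ - g) θ - M.L * inner ℝ g (θ - g) = M.L * ‖θ - g‖ ^ 2 := by
    rw [← h4]; ring
  change M.f i (z + M.L • (θ - g)) ≤ M.f i z + M.L * inner ℝ g (θ - g) + _ at h2
  linarith

/-- Both sides are the trace of `X B Θᵀ`, up to transposition and cyclic permutation. -/
theorem sum_inner_mul_eq (X : Matrix (Fin n) (Fin d) ℝ) (B : Matrix (Fin d) (Fin q) ℝ)
    (Θ : Matrix (Fin n) (Fin q) ℝ) :
    ∑ i, inner ℝ (WithLp.toLp 2 ((X * B) i) : EuclideanSpace ℝ (Fin q)) (WithLp.toLp 2 (Θ i))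
      = ∑ j, inner ℝ (WithLp.toLp 2 ((X.transpose * Θ) j) : EuclideanSpace ℝ (Fin q))
          (WithLp.toLp 2 (B j)) := by
  have h1 : ∀ i, inner ℝ (WithLp.toLp 2 ((X * B) i) : EuclideanSpace ℝ (Fin q))
      (WithLp.toLp 2 (Θ i)) = ((X * B) * Θ.transpose) i i := fun i => by
    simp [PiLp.inner_apply, Matrix.mul_apply (N := Θ.transpose), mul_comm]
  have h2 : ∀ j, inner ℝ (WithLp.toLp 2 ((X.transpose * Θ) j) : EuclideanSpace ℝ (Fin q))
      (WithLp.toLp 2 (B j)) = ((X.transpose * Θ) * B.transpose) j j := fun i => by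
    simp [PiLp.inner_apply, Matrix.mul_apply (N := B.transpose), mul_comm]
  simp only [h1, h2]
  change Matrix.trace _ = Matrix.trace _
  rw [← Matrix.trace_transpose, Matrix.transpose_mul, Matrix.transpose_mul,
    Matrix.transpose_transpose, Matrix.trace_mul_comm, Matrix.mul_assoc, Matrix.trace_mul_comm]

/-- The distance of a dual point to the gradients at `B` is controlled by the duality gap, if the
dual point satisfies the dual constraints on the features outside which `B` vanishes. -/
theorem sum_sq_sub_lossGrad_le (M : GroupOWL n d q) {A : Finset (Fin d)}
    {B : Matrix (Fin d) (Fin q) ℝ} (hB : ∀ j ∉ A, B j = 0) {Θ : Matrix (Fin n) (Fin q) ℝ}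
    (hΘ : ∀ i, BddAbove (Set.range fun z : EuclideanSpace ℝ (Fin q) =>
      inner ℝ z (WithLp.toLp 2 (Θ i)) - M.f i z))
    (hA : ∀ S ⊆ A, ∑ j ∈ S, rowNorm (M.X.transpose * Θ) j
      ≤ ∑ i : Fin d with i.val < S.card, M.lam i) :
    M.L / 2 * ∑ i, rowNorm (Θ - M.lossGrad B) i ^ 2 ≤ M.gap B Θ := by
  have h1 : ∀ i, _ := fun i => M.fenchelYoung_add_sq_le i (hΘ i) (WithLp.toLp 2 ((M.X * B) i))
  have h2 := Finset.sum_le_sum fun i (_ : i ∈ Finset.univ) => h1 i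
  simp only [Finset.sum_add_distrib, ← Finset.mul_sum] at h2
  rw [sum_inner_mul_eq] at h2
  have h3 : -M.penalty B ≤ ∑ j, inner ℝ (WithLp.toLp 2 ((M.X.transpose * Θ) j) :
      EuclideanSpace ℝ (Fin q)) (WithLp.toLp 2 (B j)) := by
    have h4 := sum_mul_le_sum_mul_sortDesc A M.lam_nonneg (rowNorm_nonneg B)
      (fun j hj => rowNorm_eq_zero.mpr (hB j hj)) hA
    refine (neg_le_neg h4).trans ?_
    rw [← Finset.sum_neg_distrib]
    exact Finset.sum_le_sum fun j _ => (abs_le.mp (abs_real_inner_le_norm _ _)).1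
  have h5 : ∑ i, rowNorm (Θ - M.lossGrad B) i ^ 2 = ∑ i, ‖(WithLp.toLp 2 (Θ i) :
      EuclideanSpace ℝ (Fin q)) - gradient (M.f i) (WithLp.toLp 2 ((M.X * B) i))‖ ^ 2 := rfl
  have h6 : M.gap B Θ = ∑ i, M.f i (WithLp.toLp 2 ((M.X * B) i)) + M.penalty B
      + ∑ i, M.conj i (WithLp.toLp 2 (Θ i)) := by
    simp [gap, primal, loss, dual]
  rw [h5, h6]
  linarith

theorem toLp_transpose_mul (X : Matrix (Fin n) (Fin d) ℝ) (Θ : Matrix (Fin n) (Fin q) ℝ)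
    (j : Fin d) : (WithLp.toLp 2 ((X.transpose * Θ) j) : EuclideanSpace ℝ (Fin q))
      = ∑ i, X i j • WithLp.toLp 2 (Θ i) := by
  ext k
  simp [Matrix.mul_apply]

theorem rowNorm_transpose_mul_le (X : Matrix (Fin n) (Fin d) ℝ) (Θ : Matrix (Fin n) (Fin q) ℝ)
    (j : Fin d) :
    rowNorm (X.transpose * Θ) j ≤ rowNorm X.transpose j * √(∑ i, rowNorm Θ i ^ 2) := by
  have h1 : rowNorm (X.transpose * Θ) j ≤ ∑ i, |X i j| * rowNorm Θ i := by
    rw [rowNorm, toLp_transpose_mul]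
    refine (norm_sum_le _ _).trans_eq (Finset.sum_congr rfl fun i _ => ?_)
    rw [norm_smul, Real.norm_eq_abs]
    rfl
  refine h1.trans ((Real.sum_mul_le_sqrt_mul_sqrt _ _ _).trans_eq ?_)
  congr 1
  rw [rowNorm, EuclideanSpace.norm_eq]
  simp

theorem rowNorm_add_le {m q : ℕ} (B C : Matrix (Fin m) (Fin q) ℝ) (i : Fin m) :
    rowNorm (B + C) i ≤ rowNorm B i + rowNorm C i :=
  norm_add_le (WithLp.toLp 2 (B i) : EuclideanSpace ℝ (Fin q)) (WithLp.toLp 2 (C i))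

/-- A row of an optimum that vanishes off `A` is zero if its loss gradient is less than the last
of the first `|A|` weights. -/
theorem IsOptimum.row_eq_zero {M : GroupOWL n d q} {B : Matrix (Fin d) (Fin q) ℝ}
    (hB : M.IsOptimum B) {A : Finset (Fin d)} (hA : ∀ j ∉ A, B j = 0) {j l : Fin d}
    (hl : (l : ℕ) = A.card - 1)
    (hj : rowNorm (M.X.transpose * M.lossGrad B) j < M.lam l) : B j = 0 := by
  by_contra hne
  have hb : 0 < rowNorm B j := lt_of_le_of_ne (rowNorm_nonneg B j)
    fun h => hne (rowNorm_eq_zero.mp h.symm)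
  set b : EuclideanSpace ℝ (Fin q) := WithLp.toLp 2 (B j) with hbdef
  set C : ℝ := ∑ i, 1 / M.L / 2 * ‖M.X i j • b‖ ^ 2
  have key : ∀ t : ℝ, 0 < t → t < 1 →
      (M.lam l - rowNorm (M.X.transpose * M.lossGrad B) j) * rowNorm B j ≤ C * t := by
    intro t ht0 ht1
    -- The row is shrunk, not deleted: a positive norm keeps it among the first `|A|` sorted
    -- positions, and the quadratic loss error disappears as `t → 0`.
    set B' : Matrix (Fin d) (Fin q) ℝ := B.updateRow j ((1 - t) • B j) with hB'
    have hrow : rowNorm B' j = (1 - t) * rowNorm B j := by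
      rw [rowNorm, hB', Matrix.updateRow_self, WithLp.toLp_smul, norm_smul,
        Real.norm_of_nonneg (by linarith)]
      rfl
    have hrow' : ∀ i ≠ j, B' i = B i := fun i hi => Matrix.updateRow_ne hi
    have hpen : M.penalty B' + M.lam l * (rowNorm B j - rowNorm B' j) ≤ M.penalty B := by
      refine sum_mul_sortDesc_add_le (A := A) M.lam_antitone hl
        (fun i hi => by rw [rowNorm, hrow' i hi]; rfl) ?_ ?_ ?_
      · rw [hrow]; exact mul_pos (by linarith) hb
      · rw [hrow]; nlinarith
      · intro i hi
        have hij : i ≠ j := fun h => hne (hA j (h ▸ hi))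
        rw [rowNorm_eq_zero, hrow' i hij, hA i hi]
    have hfit : ∀ i, (WithLp.toLp 2 ((M.X * B') i) : EuclideanSpace ℝ (Fin q))
        = WithLp.toLp 2 ((M.X * B) i) + (-t) • (M.X i j • b) := by
      intro i
      ext k
      simp only [Matrix.mul_apply, PiLp.add_apply, PiLp.smul_apply, smul_eq_mul, hbdef]
      rw [← sub_eq_iff_eq_add', ← Finset.sum_sub_distrib, Finset.sum_eq_single j]
      · simp only [hB', Matrix.updateRow_self, Pi.smul_apply, smul_eq_mul]
        ring
      · intro x _ hx; rw [hrow' x hx, sub_self]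
      · simp
    have hloss : M.loss B' ≤ M.loss B
        + (-t) * inner ℝ (WithLp.toLp 2 ((M.X.transpose * M.lossGrad B) j)) b + C * t ^ 2 := by
      have h1 : ∀ i, M.f i (WithLp.toLp 2 ((M.X * B') i)) ≤ M.f i (WithLp.toLp 2 ((M.X * B) i))
          + (-t) * inner ℝ (M.X i j • WithLp.toLp 2 (M.lossGrad B i)) b
          + 1 / M.L / 2 * ‖M.X i j • b‖ ^ 2 * t ^ 2 := by
        intro i
        rw [hfit i]
        refine (le_add_inner_gradient_add_sq (M.f_diff i) (M.f_grad i) _ _).trans_eq ?_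
        rw [inner_smul_right, inner_smul_right, real_inner_smul_left, norm_smul (-t), mul_pow,
          Real.norm_eq_abs, sq_abs]
        change _ = _ + -t * (_ * inner ℝ (gradient (M.f i) (WithLp.toLp 2 ((M.X * B) i))) b) + _
        ring
      refine (Finset.sum_le_sum fun i _ => h1 i).trans_eq ?_
      rw [Finset.sum_add_distrib, Finset.sum_add_distrib, ← Finset.sum_mul, ← Finset.mul_sum,
        ← sum_inner, ← toLp_transpose_mul]
      rfl
    have hin : -(rowNorm (M.X.transpose * M.lossGrad B) j * rowNorm B j)
        ≤ inner ℝ (WithLp.toLp 2 ((M.X.transpose * M.lossGrad B) j)) b :=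
      (abs_le.mp (abs_real_inner_le_norm _ _)).1
    have hopt := hB B'
    rw [primal, primal] at hopt
    rw [hrow] at hpen
    have h2 := mul_le_mul_of_nonneg_left hin ht0.le
    have h3 : t * ((M.lam l - rowNorm (M.X.transpose * M.lossGrad B) j) * rowNorm B j)
        ≤ t * (C * t) := by nlinarith
    exact le_of_mul_le_mul_left h3 ht0
  have hlim : Tendsto (fun t : ℝ => C * t) (𝓝[>] 0) (𝓝 0) := by
    have : Tendsto (fun t : ℝ => C * t) (𝓝 0) (𝓝 (C * 0)) := tendsto_id.const_mul C
    rw [mul_zero] at this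
    exact this.mono_left nhdsWithin_le_nhds
  have h4 := ge_of_tendsto hlim (b := (M.lam l - rowNorm (M.X.transpose * M.lossGrad B) j)
    * rowNorm B j) (by
      filter_upwards [Ioo_mem_nhdsGT (zero_lt_one' ℝ)] with t ht using key t ht.1 ht.2)
  have h5 := mul_pos (sub_pos.mpr hj) hb
  linarith

/-- A feature that fails the screening test has zero coefficients in the optimum. -/
theorem IsOptimum.row_eq_zero_of_screened {M : GroupOWL n d q} {B : Matrix (Fin d) (Fin q) ℝ}
    (hB : M.IsOptimum B) {A : Finset (Fin d)} (hBA : ∀ j ∉ A, B j = 0)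
    {Θ : Matrix (Fin n) (Fin q) ℝ} {G : ℝ}
    (hΘ : ∀ i, BddAbove (Set.range fun z : EuclideanSpace ℝ (Fin q) =>
      inner ℝ z (WithLp.toLp 2 (Θ i)) - M.f i z))
    (hA : ∀ S ⊆ A, ∑ j ∈ S, rowNorm (M.X.transpose * Θ) j
      ≤ ∑ i : Fin d with i.val < S.card, M.lam i)
    (hG : M.gap B Θ ≤ G) {j l : Fin d} (hl : (l : ℕ) = A.card - 1)
    (hj : rowNorm (M.X.transpose * Θ) j + rowNorm M.X.transpose j * √(2 * G / M.L) < M.lam l) :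
    B j = 0 := by
  refine hB.row_eq_zero hBA hl (lt_of_le_of_lt ?_ hj)
  have h1 := (M.sum_sq_sub_lossGrad_le hBA hΘ hA).trans hG
  have h2 : ∑ i, rowNorm (M.lossGrad B - Θ) i ^ 2 ≤ 2 * G / M.L := by
    rw [le_div_iff₀ M.L_pos]
    have h3 : ∀ i, rowNorm (M.lossGrad B - Θ) i = rowNorm (Θ - M.lossGrad B) i := fun i =>
      norm_sub_rev (WithLp.toLp 2 (M.lossGrad B i) : EuclideanSpace ℝ (Fin q))
        (WithLp.toLp 2 (Θ i))
    simp only [h3]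
    linarith
  have h4 := rowNorm_transpose_mul_le M.X (M.lossGrad B - Θ) j
  have h5 := rowNorm_add_le (M.X.transpose * Θ) (M.X.transpose * (M.lossGrad B - Θ)) j
  rw [← Matrix.mul_add, add_sub_cancel] at h5
  refine h5.trans (add_le_add le_rfl (h4.trans ?_))
  exact mul_le_mul_of_nonneg_left (Real.sqrt_le_sqrt h2) (rowNorm_nonneg _ _)

/-! ### Reduced models, zero padding and the screening loop. -/

theorem extendCoeff_orderEmbOfFin (A : Finset (Fin d)) (C : Matrix (Fin A.card) (Fin q) ℝ)
    (i : Fin A.card) : extendCoeff A C (A.orderEmbOfFin rfl i) = C i :=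
  (A.orderEmbOfFin rfl).injective.extend_apply (fun i => C i) 0 i

theorem extendCoeff_of_notMem {A : Finset (Fin d)} (C : Matrix (Fin A.card) (Fin q) ℝ)
    {j : Fin d} (hj : j ∉ A) : extendCoeff A C j = 0 :=
  Function.extend_apply' _ _ _ fun ⟨i, hi⟩ => hj (hi ▸ A.orderEmbOfFin_mem rfl i)

theorem exists_orderEmbOfFin_eq {A : Finset (Fin d)} {j : Fin d} (hj : j ∈ A) :
    ∃ i, A.orderEmbOfFin rfl i = j := by
  rwa [← Finset.mem_coe, ← A.range_orderEmbOfFin rfl] at hj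

theorem extendCoeff_restrictCoeff {A : Finset (Fin d)} {B : Matrix (Fin d) (Fin q) ℝ}
    (hB : ∀ j ∉ A, B j = 0) : extendCoeff A (restrictCoeff A B) = B := by
  ext j : 1
  by_cases hj : j ∈ A
  · obtain ⟨i, rfl⟩ := exists_orderEmbOfFin_eq hj
    rw [extendCoeff_orderEmbOfFin]
    rfl
  · rw [extendCoeff_of_notMem _ hj, hB j hj]

theorem continuous_extendCoeff (A : Finset (Fin d)) :
    Continuous (extendCoeff A : Matrix (Fin A.card) (Fin q) ℝ → Matrix (Fin d) (Fin q) ℝ) := by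
  refine continuous_pi fun j => ?_
  by_cases hj : j ∈ A
  · obtain ⟨i, rfl⟩ := exists_orderEmbOfFin_eq hj
    simp only [extendCoeff_orderEmbOfFin]
    exact continuous_apply i
  · simp only [extendCoeff_of_notMem _ hj]
    exact continuous_const

/-- The objective of the reduced model is that of the full model at the zero-padded matrix. -/
theorem primal_restrict (M : GroupOWL n d q) (A : Finset (Fin d))
    (C : Matrix (Fin A.card) (Fin q) ℝ) :
    (M.restrict A).primal C = M.primal (extendCoeff A C) := by
  have hloss : (M.restrict A).loss C = M.loss (extendCoeff A C) := by
    refine Finset.sum_congr rfl fun i _ => ?_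
    refine congrArg (fun z => M.f i (WithLp.toLp 2 z)) (funext fun k => ?_)
    simp only [Matrix.mul_apply]
    refine Fintype.sum_of_injective _ (A.orderEmbOfFin rfl).injective _ _ ?_ ?_
    · intro j hj
      rw [Finset.range_orderEmbOfFin] at hj
      rw [extendCoeff_of_notMem C hj, Pi.zero_apply, mul_zero]
    · intro j
      rw [extendCoeff_orderEmbOfFin]
      rfl
  have hpen : M.penalty (extendCoeff A C) = (M.restrict A).penalty C :=
    sum_mul_sortDesc_of_extend M.lam (rowNorm_nonneg C)
      (fun i => by rw [rowNorm, extendCoeff_orderEmbOfFin]; rfl)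
      fun j hj => rowNorm_eq_zero.mpr (extendCoeff_of_notMem C hj)
  rw [primal, primal, hloss, hpen]

/-- If some optimum of the full model vanishes off `A`, then the optima of the model reduced to
`A` are optima of the full model. -/
theorem IsOptimum.extendCoeff {M : GroupOWL n d q} {A : Finset (Fin d)}
    {B : Matrix (Fin d) (Fin q) ℝ} (hB : M.IsOptimum B) (hBA : ∀ j ∉ A, B j = 0)
    {C : Matrix (Fin A.card) (Fin q) ℝ} (hC : (M.restrict A).IsOptimum C) :
    M.IsOptimum (extendCoeff A C) := by
  intro B'
  have h := hC (restrictCoeff A B)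
  rw [primal_restrict, primal_restrict, extendCoeff_restrictCoeff hBA] at h
  exact h.trans (hB B')

theorem exists_isOptimum_of_restrict_univ {M : GroupOWL n d q}
    (h : ∃ C, (M.restrict Finset.univ).IsOptimum C) : ∃ B, M.IsOptimum B := by
  obtain ⟨C, hC⟩ := h
  refine ⟨GroupOWL.extendCoeff _ C, fun B' => ?_⟩
  have h := hC (restrictCoeff _ B')
  rwa [primal_restrict, primal_restrict, extendCoeff_restrictCoeff (by simp)] at h

/-- Bounds on all subset sums, unlike bounds on sorted partial sums, are inherited by smaller active
sets without sorting again. -/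
theorem DualFeasible.sum_le {M : GroupOWL n d q} {A : Finset (Fin d)}
    {Θ : Matrix (Fin n) (Fin q) ℝ} (h : (M.restrict A).DualFeasible Θ) {S : Finset (Fin d)}
    (hS : S ⊆ A) : ∑ j ∈ S, rowNorm (M.X.transpose * Θ) j
      ≤ ∑ i : Fin d with i.val < S.card, M.lam i := by
  have hA := A.map_orderEmbOfFin_univ rfl
  rw [← hA, Finset.subset_map_iff] at hS
  obtain ⟨T, -, rfl⟩ := hS
  rw [Finset.sum_map, Finset.card_map,
    ← sum_filter_castLE (card_finset_fin_le A) (card_finset_fin_le T)]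
  refine (sum_le_sum_sortDesc (rowNorm ((M.restrict A).X.transpose * Θ)) T).trans ?_
  -- `Finset.Iic i` has `i + 1` elements, so the empty set needs its own case.
  rcases Nat.eq_zero_or_pos T.card with h0 | h0
  · simp [h0]
  · have hT := card_finset_fin_le T
    have hI : (Finset.univ.filter fun i : Fin A.card => i.val < T.card)
        = Finset.Iic ⟨T.card - 1, by omega⟩ := by
      ext i
      simp only [Finset.mem_filter, Finset.mem_univ, true_and, Finset.mem_Iic, Fin.le_def]
      omega
    rw [hI]
    exact h.2 _

theorem screenPass_subset (M : GroupOWL n d q) (Θ : Matrix (Fin n) (Fin q) ℝ) (G : ℝ)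
    (A : Finset (Fin d)) : M.screenPass Θ G A ⊆ A := by
  classical
  exact Finset.filter_subset _ _

theorem screen_subset (M : GroupOWL n d q) (Θ : Matrix (Fin n) (Fin q) ℝ) (G : ℝ)
    (A : Finset (Fin d)) : M.screen Θ G A ⊆ A := by
  have h : ∀ k, (M.screenPass Θ G)^[k] A ⊆ A := by
    intro k
    induction k with
    | zero => exact subset_rfl
    | succ k ih =>
      rw [Function.iterate_succ_apply']
      exact (M.screenPass_subset Θ G _).trans ih
  exact h d

/-- The screening loop on a reduced model, with a dual feasible point and an upper bound on the
duality gap at the optimum, removes only features with zero optimal coefficients. -/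
theorem IsOptimum.row_eq_zero_of_notMem_screen {M : GroupOWL n d q}
    {B : Matrix (Fin d) (Fin q) ℝ} (hB : M.IsOptimum B) {A : Finset (Fin d)}
    (hBA : ∀ j ∉ A, B j = 0) {Θ : Matrix (Fin n) (Fin q) ℝ}
    (hΘ : (M.restrict A).DualFeasible Θ) {G : ℝ} (hG : M.gap B Θ ≤ G) :
    ∀ j ∉ M.screen Θ G A, B j = 0 := by
  have h : ∀ k, (M.screenPass Θ G)^[k] A ⊆ A ∧ ∀ j ∉ (M.screenPass Θ G)^[k] A, B j = 0 := by
    intro k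
    induction k with
    | zero => exact ⟨subset_rfl, hBA⟩
    | succ k ih =>
      rw [Function.iterate_succ_apply']
      refine ⟨(M.screenPass_subset Θ G _).trans ih.1, fun j hj => ?_⟩
      by_cases hjk : j ∈ (M.screenPass Θ G)^[k] A
      · simp only [screenPass, Finset.mem_filter, hjk, true_and, not_not] at hj
        -- `Θ` and `G` stay fixed during the loop: the subset form of the dual constraints restricts
        -- to the current set, and `M.gap B Θ` does not depend on it.
        exact hB.row_eq_zero_of_screened ih.2 hΘ.1 (fun S hS => hΘ.sum_le (hS.trans ih.1)) hG
          rfl hj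
      · exact ih.2 j hjk
  exact (h d).2

end GroupOWL

/-! ### Runs with screening. -/

namespace IterativeAlgorithm

open GroupOWL

variable {n d q : ℕ} {Ξ : Type v}

theorem newActive_subset (Ψ : IterativeAlgorithm.{u} n q Ξ) (dualPt : Ψ.DualRule)
    (M : GroupOWL n d q) (s : Ψ.ScreenedState M) : Ψ.newActive dualPt M s ⊆ s.1 :=
  M.screen_subset _ _ _

theorem screenedStep_of_newActive_eq {Ψ : IterativeAlgorithm.{u} n q Ξ} {dualPt : Ψ.DualRule}
    {M : GroupOWL n d q} {s : Ψ.ScreenedState M} (h : Ψ.newActive dualPt M s = s.1) (ξ : Ξ) :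
    Ψ.screenedStep dualPt M s ξ = ⟨s.1, Ψ.step (M.restrict s.1) s.2 ξ⟩ :=
  if_pos h

/-- The starting point of a restart on the reduced model given by the screening of `s`. -/
def restartCoeff (Ψ : IterativeAlgorithm.{u} n q Ξ) (dualPt : Ψ.DualRule)
    (M : GroupOWL n d q) (s : Ψ.ScreenedState M) :
    Matrix (Fin (Ψ.newActive dualPt M s).card) (Fin q) ℝ :=
  restrictCoeff (Ψ.newActive dualPt M s) (extendCoeff s.1 (Ψ.restartPoint (M.restrict s.1) s.2))

theorem screenedStep_of_newActive_ne {Ψ : IterativeAlgorithm.{u} n q Ξ} {dualPt : Ψ.DualRule}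
    {M : GroupOWL n d q} {s : Ψ.ScreenedState M} (h : Ψ.newActive dualPt M s ≠ s.1) (ξ : Ξ) :
    Ψ.screenedStep dualPt M s ξ = ⟨Ψ.newActive dualPt M s,
      Ψ.step (M.restrict (Ψ.newActive dualPt M s))
        (Ψ.start (M.restrict (Ψ.newActive dualPt M s)) (Ψ.restartCoeff dualPt M s)) ξ⟩ :=
  if_neg h

theorem screenedStep_fst (Ψ : IterativeAlgorithm.{u} n q Ξ) (dualPt : Ψ.DualRule)
    (M : GroupOWL n d q) (s : Ψ.ScreenedState M) (ξ : Ξ) :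
    (Ψ.screenedStep dualPt M s ξ).1 = Ψ.newActive dualPt M s := by
  by_cases h : Ψ.newActive dualPt M s = s.1
  · rw [screenedStep_of_newActive_eq h, h]
  · rw [screenedStep_of_newActive_ne h]

theorem activeSet_succ (Ψ : IterativeAlgorithm.{u} n q Ξ) (dualPt : Ψ.DualRule)
    (M : GroupOWL n d q) (B₀ : Matrix (Fin d) (Fin q) ℝ) (ω : ℕ → Ξ) (k : ℕ) :
    Ψ.activeSet dualPt M B₀ ω (k + 1)
      = Ψ.newActive dualPt M (Ψ.screenedRun dualPt M B₀ ω k) :=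
  Ψ.screenedStep_fst dualPt M _ _

theorem antitone_activeSet (Ψ : IterativeAlgorithm.{u} n q Ξ) (dualPt : Ψ.DualRule)
    (M : GroupOWL n d q) (B₀ : Matrix (Fin d) (Fin q) ℝ) (ω : ℕ → Ξ) :
    Antitone (Ψ.activeSet dualPt M B₀ ω) :=
  antitone_nat_of_succ_le fun k => by
    rw [activeSet_succ]
    exact Ψ.newActive_subset dualPt M _

/-- Screening is safe: every optimum vanishes on the removed features. -/
theorem eq_zero_of_notMem_activeSet {Ψ : IterativeAlgorithm.{u} n q Ξ} {dualPt : Ψ.DualRule}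
    {M : GroupOWL n d q}
    (hdual : ∀ (A : Finset (Fin d)) (s : Ψ.State (M.restrict A)),
      (M.restrict A).DualFeasible (dualPt (M.restrict A) s))
    (B₀ : Matrix (Fin d) (Fin q) ℝ) (ω : ℕ → Ξ) {B : Matrix (Fin d) (Fin q) ℝ}
    (hB : M.IsOptimum B) (k : ℕ) : ∀ i ∉ Ψ.activeSet dualPt M B₀ ω k, B i = 0 := by
  induction k with
  | zero => exact fun i hi => absurd (Finset.mem_univ i) hi
  | succ k ih =>
    rw [activeSet_succ]
    refine hB.row_eq_zero_of_notMem_screen ih (hdual _ _) ?_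
    -- The dual value is the same in the reduced and full models, so the gap at the optimum is at
    -- most the computed gap once the primal values are compared.
    refine sub_le_sub_right ?_ _
    rw [primal_restrict]
    exact hB _

/-- If a state of the run with screening after `k` steps is a state after `m` steps of a run
without screening on the reduced model, and no feature is removed afterwards, then the runs
agree from then on. -/
theorem screenedRun_eq_run (Ψ : IterativeAlgorithm.{u} n q Ξ) (dualPt : Ψ.DualRule)
    (M : GroupOWL n d q) (B₀ : Matrix (Fin d) (Fin q) ℝ) (ω : ℕ → Ξ) {A : Finset (Fin d)}
    {C : Matrix (Fin A.card) (Fin q) ℝ} {k m : ℕ} (η : ℕ → Ξ)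
    (hη : ∀ j, η (m + j) = ω (k + j))
    (hk : Ψ.screenedRun dualPt M B₀ ω k = ⟨A, Ψ.run (M.restrict A) C η m⟩)
    (hA : ∀ j, Ψ.activeSet dualPt M B₀ ω (k + j) = A) (j : ℕ) :
    Ψ.screenedRun dualPt M B₀ ω (k + j) = ⟨A, Ψ.run (M.restrict A) C η (m + j)⟩ := by
  induction j with
  | zero => exact hk
  | succ j ih =>
    have h1 := hA (j + 1)
    rw [← add_assoc, activeSet_succ, ih] at h1
    rw [← add_assoc, ← add_assoc]
    change Ψ.screenedStep dualPt M (Ψ.screenedRun dualPt M B₀ ω (k + j)) (ω (k + j)) = _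
    rw [ih, ← hη j]
    exact screenedStep_of_newActive_eq h1 _

/-- From some iteration on, the iterates with screening are those of the algorithm on a reduced
model, started either at the beginning or at the last restart. -/
theorem exists_eventually_screenedIterates_eq (Ψ : IterativeAlgorithm.{u} n q Ξ)
    (dualPt : Ψ.DualRule) (M : GroupOWL n d q) (B₀ : Matrix (Fin d) (Fin q) ℝ) (ω : ℕ → Ξ) :
    (∀ j, Ψ.screenedIterates dualPt M B₀ ω j = extendCoeff Finset.univ
      (Ψ.iterates (M.restrict Finset.univ) (restrictCoeff Finset.univ B₀) ω j)) ∨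
    ∃ k, ∀ j, Ψ.screenedIterates dualPt M B₀ ω (k + 1 + j)
      = extendCoeff (Ψ.newActive dualPt M (Ψ.screenedRun dualPt M B₀ ω k))
        (Ψ.iterates (M.restrict (Ψ.newActive dualPt M (Ψ.screenedRun dualPt M B₀ ω k)))
          (Ψ.restartCoeff dualPt M (Ψ.screenedRun dualPt M B₀ ω k))
          (fun i => ω (k + i)) (1 + j)) := by
  classical
  have hanti := Ψ.antitone_activeSet dualPt M B₀ ω
  have hstab : ∃ N, ∀ m ≥ N, Ψ.activeSet dualPt M B₀ ω m = Ψ.activeSet dualPt M B₀ ω N := by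
    obtain ⟨N, hN⟩ := WellFoundedGT.monotone_chain_condition
      (α := (Finset (Fin d))ᵒᵈ) ⟨fun k => OrderDual.toDual (Ψ.activeSet dualPt M B₀ ω k), hanti⟩
    exact ⟨N, fun m hm => (hN m hm).symm⟩
  have hspec := Nat.find_spec hstab
  -- If the first stable time is `k + 1`, minimality forces a removal, hence a restart, at the
  -- iteration leading to it.
  rcases hN : Nat.find hstab with _ | k
  · left
    intro j
    rw [hN] at hspec
    have h := Ψ.screenedRun_eq_run dualPt M B₀ ω (k := 0) (m := 0) ω (fun _ => rfl) rfl
      (fun j => hspec (0 + j) (Nat.zero_le _)) j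
    rw [zero_add] at h
    rw [screenedIterates, h]
    rfl
  · right
    refine ⟨k, fun j => ?_⟩
    rw [hN] at hspec
    have hmin := Nat.find_min hstab (m := k) (by omega)
    have hne : Ψ.newActive dualPt M (Ψ.screenedRun dualPt M B₀ ω k)
        ≠ (Ψ.screenedRun dualPt M B₀ ω k).1 := by
      intro h
      rw [← activeSet_succ] at h
      refine hmin fun m hm => ?_
      rcases Nat.eq_or_lt_of_le hm with rfl | hm
      · rfl
      · exact (hspec m hm).trans h
    -- The restart and one step share an iteration, so the state is that of the restarted run after
    -- `1` step, with noise read from `ω k` on.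
    have hk : Ψ.screenedRun dualPt M B₀ ω (k + 1)
        = ⟨Ψ.newActive dualPt M (Ψ.screenedRun dualPt M B₀ ω k),
            Ψ.run (M.restrict (Ψ.newActive dualPt M (Ψ.screenedRun dualPt M B₀ ω k)))
              (Ψ.restartCoeff dualPt M (Ψ.screenedRun dualPt M B₀ ω k))
              (fun i => ω (k + i)) 1⟩ :=
      screenedStep_of_newActive_ne hne (ω k)
    have h := Ψ.screenedRun_eq_run dualPt M B₀ ω _ (fun j => by rw [add_assoc]) hk
      (fun j => by
        rw [hspec (k + 1 + j) (by omega)]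
        exact Ψ.activeSet_succ dualPt M B₀ ω k) j
    rw [screenedIterates, h]
    rfl

/-- Lets an almost sure statement hold simultaneously for all restart points that can occur at time
`k`. -/
theorem countable_range_screenedRun [Countable Ξ] (Ψ : IterativeAlgorithm.{u} n q Ξ)
    (dualPt : Ψ.DualRule) (M : GroupOWL n d q) (B₀ : Matrix (Fin d) (Fin q) ℝ) (k : ℕ) :
    (Set.range fun ω => Ψ.screenedRun dualPt M B₀ ω k).Countable := by
  induction k with
  | zero =>
    exact (Set.countable_singleton (⟨Finset.univ, Ψ.start (M.restrict Finset.univ)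
      (restrictCoeff Finset.univ B₀)⟩ : Ψ.ScreenedState M)).mono
        (Set.range_subset_iff.mpr fun _ => rfl)
  | succ k ih =>
    refine (ih.image2 (Set.countable_univ (α := Ξ)) (Ψ.screenedStep dualPt M)).mono ?_
    rintro _ ⟨ω, rfl⟩
    exact Set.mem_image2_of_mem ⟨ω, rfl⟩ (Set.mem_univ (ω k))

end IterativeAlgorithm

/-! ### Almost sure convergence. -/

/-- The shift preserves the law of a sequence of independent identically distributed elements. -/
theorem measurePreserving_shift_infinitePi {Ξ : Type v} [MeasurableSpace Ξ] (ν : Measure Ξ)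
    [IsProbabilityMeasure ν] (k : ℕ) :
    MeasurePreserving (fun (ω : ℕ → Ξ) i => ω (k + i)) (Measure.infinitePi fun _ : ℕ => ν)
      (Measure.infinitePi fun _ : ℕ => ν) := by
  classical
  have hm : Measurable fun (ω : ℕ → Ξ) i => ω (k + i) :=
    measurable_pi_lambda _ fun i => measurable_pi_apply _
  refine ⟨hm, Measure.eq_infinitePi _ fun s t ht => ?_⟩
  rw [Measure.map_apply hm (MeasurableSet.pi s.countable_toSet fun i _ => ht i)]
  -- The preimage of a box is a box on shifted indices, all at least `k`, so the truncated `i - k`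
  -- is exact.
  have h : (fun (ω : ℕ → Ξ) i => ω (k + i)) ⁻¹' (Set.pi s t)
      = Set.pi (s.map (addLeftEmbedding k)) (fun i => t (i - k)) := by
    ext ω
    simp [Set.mem_pi]
  rw [h, Measure.infinitePi_pi _ (fun i _ => ht _), Finset.prod_map]
  simp

namespace IterativeAlgorithm

open GroupOWL

variable {n d q : ℕ} {Ξ : Type v}

/-- Almost surely, from some iteration on, the iterates with screening are those of a run on a
reduced model that is generic for a given almost sure property of the runs. -/
theorem ae_exists_eventually_screenedIterates_eq [Countable Ξ] [MeasurableSpace Ξ]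
    (ν : Measure Ξ) [IsProbabilityMeasure ν] (Ψ : IterativeAlgorithm.{u} n q Ξ)
    (dualPt : Ψ.DualRule) (M : GroupOWL n d q)
    {Q : (A : Finset (Fin d)) → (ℕ → Matrix (Fin A.card) (Fin q) ℝ) → Prop}
    (hQ : ∀ (A : Finset (Fin d)) (C : Matrix (Fin A.card) (Fin q) ℝ),
      ∀ᵐ ω ∂(Measure.infinitePi fun _ : ℕ => ν), Q A (Ψ.iterates (M.restrict A) C ω))
    (B₀ : Matrix (Fin d) (Fin q) ℝ) :
    ∀ᵐ ω ∂(Measure.infinitePi fun _ : ℕ => ν), ∃ (A : Finset (Fin d))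
      (C : ℕ → Matrix (Fin A.card) (Fin q) ℝ) (k m : ℕ), Q A C ∧
      A = Ψ.activeSet dualPt M B₀ ω k ∧
      ∀ j, Ψ.screenedIterates dualPt M B₀ ω (j + k) = extendCoeff A (C (j + m)) := by
  -- The state `s` ranges over all reachable states instead of being the random one, so no
  -- conditioning on the past is needed; `s` is specialized to the actual state afterwards.
  have h1 : ∀ᵐ ω ∂(Measure.infinitePi fun _ : ℕ => ν), ∀ k,
      ∀ s ∈ Set.range fun ω' => Ψ.screenedRun dualPt M B₀ ω' k,
        Q (Ψ.newActive dualPt M s) (Ψ.iterates (M.restrict (Ψ.newActive dualPt M s))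
          (Ψ.restartCoeff dualPt M s) fun i => ω (k + i)) := by
    rw [ae_all_iff]
    intro k
    rw [ae_ball_iff (Ψ.countable_range_screenedRun dualPt M B₀ k)]
    intro s _
    exact (measurePreserving_shift_infinitePi ν k).quasiMeasurePreserving.ae (hQ _ _)
  filter_upwards [h1, hQ Finset.univ (restrictCoeff Finset.univ B₀)] with ω hω hω0
  rcases Ψ.exists_eventually_screenedIterates_eq dualPt M B₀ ω with h | ⟨k, h⟩
  · exact ⟨_, _, 0, 0, hω0, rfl, h⟩
  · refine ⟨_, _, k + 1, 1, hω k _ ⟨ω, rfl⟩, (Ψ.activeSet_succ dualPt M B₀ ω k).symm,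
      fun j => ?_⟩
    rw [add_comm j, add_comm j, h]

end IterativeAlgorithm

end

theorem mainTheorem4 {n d q : ℕ} (M : GroupOWL n d q)
    {Ξ : Type v} [Countable Ξ] [MeasurableSpace Ξ] [MeasurableSingletonClass Ξ]
    (ν : Measure Ξ) [IsProbabilityMeasure ν]
    (Ψ : IterativeAlgorithm.{u} n q Ξ) (dualPt : Ψ.DualRule)
    (hdual : ∀ (A : Finset (Fin d)) (s : Ψ.State (M.restrict A)),
      (M.restrict A).DualFeasible (dualPt (M.restrict A) s)) :
    ((∀ (A : Finset (Fin d)) (B₀ : Matrix (Fin A.card) (Fin q) ℝ),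
        ∀ᵐ ω ∂(Measure.infinitePi fun _ : ℕ => ν),
          (M.restrict A).IteratesConverge (Ψ.iterates (M.restrict A) B₀ ω)) →
      ∀ B₀ : Matrix (Fin d) (Fin q) ℝ,
        ∀ᵐ ω ∂(Measure.infinitePi fun _ : ℕ => ν),
          M.IteratesConverge (Ψ.screenedIterates dualPt M B₀ ω)) ∧
    ((∀ (A : Finset (Fin d)) (B₀ : Matrix (Fin A.card) (Fin q) ℝ),
        ∀ᵐ ω ∂(Measure.infinitePi fun _ : ℕ => ν),
          (M.restrict A).ValuesConverge (Ψ.iterates (M.restrict A) B₀ ω)) →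
      ∀ B₀ : Matrix (Fin d) (Fin q) ℝ,
        ∀ᵐ ω ∂(Measure.infinitePi fun _ : ℕ => ν),
          M.ValuesConverge (Ψ.screenedIterates dualPt M B₀ ω)) ∧
    (∀ (B₀ : Matrix (Fin d) (Fin q) ℝ) (ω : ℕ → Ξ) (k : ℕ) (i : Fin d),
      i ∉ Ψ.activeSet dualPt M B₀ ω k →
        ∀ Bopt, M.IsOptimum Bopt → Bopt i = 0) := by
  classical
  -- Safety only speaks about given optima, so one optimum of `M` must exist before a reduced
  -- optimum can be lifted. An almost sure event is nonempty, and a single convergent run on the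
  -- model with all features provides it.
  have hopt : ∀ (R : (A : Finset (Fin d)) → (ℕ → Matrix (Fin A.card) (Fin q) ℝ) → Prop),
      (∀ A C, R A C → ∃ B, (M.restrict A).IsOptimum B) →
      (∀ (A : Finset (Fin d)) (B₀ : Matrix (Fin A.card) (Fin q) ℝ),
        ∀ᵐ ω ∂(Measure.infinitePi fun _ : ℕ => ν), R A (Ψ.iterates (M.restrict A) B₀ ω)) →
      ∃ B, M.IsOptimum B := by
    intro R hR h
    obtain ⟨ω, hω⟩ := (h Finset.univ 0).exists
    exact GroupOWL.exists_isOptimum_of_restrict_univ (hR _ _ hω)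
  refine ⟨fun h B₀ => ?_, fun h B₀ => ?_, fun B₀ ω k i hi B hB =>
    IterativeAlgorithm.eq_zero_of_notMem_activeSet hdual B₀ ω hB k i hi⟩
  · obtain ⟨B, hB⟩ := hopt (fun A => (M.restrict A).IteratesConverge)
      (fun A C ⟨B, hB, _⟩ => ⟨B, hB⟩) h
    filter_upwards [Ψ.ae_exists_eventually_screenedIterates_eq ν dualPt M
      (Q := fun A => (M.restrict A).IteratesConverge) h B₀] with ω hω
    obtain ⟨A, C, k, m, ⟨Bopt, hBopt, hlim⟩, rfl, hC⟩ := hω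
    refine ⟨_, hB.extendCoeff
      (IterativeAlgorithm.eq_zero_of_notMem_activeSet hdual B₀ ω hB k) hBopt, ?_⟩
    rw [← tendsto_add_atTop_iff_nat k]
    simp only [hC]
    exact ((GroupOWL.continuous_extendCoeff _).tendsto _).comp
      ((tendsto_add_atTop_iff_nat m).mpr hlim)
  · obtain ⟨B, hB⟩ := hopt (fun A => (M.restrict A).ValuesConverge)
      (fun A C ⟨B, hB, _⟩ => ⟨B, hB⟩) h
    filter_upwards [Ψ.ae_exists_eventually_screenedIterates_eq ν dualPt M
      (Q := fun A => (M.restrict A).ValuesConverge) h B₀] with ω hω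
    obtain ⟨A, C, k, m, ⟨Bopt, hBopt, hlim⟩, rfl, hC⟩ := hω
    refine ⟨_, hB.extendCoeff
      (IterativeAlgorithm.eq_zero_of_notMem_activeSet hdual B₀ ω hB k) hBopt, ?_⟩
    rw [← tendsto_add_atTop_iff_nat k]
    simp only [hC, ← GroupOWL.primal_restrict]
    exact (tendsto_add_atTop_iff_nat m).mpr hlim
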